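/- Let $J=\mathbb R_+=[0,\infty)$ or $J=\mathbb R$, and let $X$ be a real or complex Banach space. Let $C_b(J,X)$ be the Banach space of bounded continuous functions $f:J\to X$ with the supremum norm, and put $f_s(t)=f(s+t)$ and $O(f)=\{f_s:s\in J\}$. Let - $EAP(J,X)$ be the set of $f\in C_b(J,X)$ for which $O(f)$ is relatively weakly compact in $C_b(J,X)$ (Eberlein almost periodic functions); - $EAP_0(J,X)$ be the set of $f\in EAP(J,X)$ such that $0$ lies in the weak closure of $O(f)$; - $AP(\mathbb R,X)$ be the set of (Bohr) almost periodic functions, and $AP(\mathbb R_+,X)$ the set of their restrictions to $\mathbb R_+$; - $m_B(u)=\lim_{T\to\infty}\frac1{2T}\int_{-T}^Tu(t)\,dt$ if $J=\mathbb R$, and $m_B(u)=\lim_{T\to\infty}\frac1T\int_0^Tu(t)\,dt$ if $J=\mathbb R_+$, whenever the limit exists; - $PAP_0(J,X)$ be the set of $f\in C_b(J,X)$ for which $m_B(\|f\|)$ exists and equals $0$, and $PAP(J,X)=AP(J,X)+PAP_0(J,X)$ (pseudo almost periodic functions). Then the following hold. 1. The inclusion $EAP(J,X)\subset PAP(J,X)$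 fails for every infinite-dimensional (real or complex) Hilbert space $X$, for $X=\ell^p(\mathbb N)$ with $1<p\le\infty$, and for $X=c_0(\mathbb N)$ (with real or complex scalars). Moreover, for each of these $X$ there is an $f\in EAP_0(J,X)\setminus PAP(J,X)$ for which neither $m_B(\|f\|)$ nor $m_B(\|f\|^2)$ exists. 2. Let $X$ be any real or complex Banach space and $f\in EAP_0(J,X)$. If $f=g+h$ with $g\in AP(J,X)$ and $h\in PAP_0(J,X)$, then $g=0$; hence $f\in PAP_0(J,X)$, so that $m_B(\|f\|)$ exists (and is $0$). In particular no $f\in EAP_0(J,X)$ for which $m_B(\|f\|)$ does not exist belongs to $PAP(J,X)$. 3. Let $X$ be any real or complex Banach space and $f\in EAP_0(J,X)\cup PAP_0(J,X)$. Then all Fourier coefficients $m_B(e^{-i\omega\,\cdot}f)$, $\omega\in\mathbb R$, exist and are $0$. (For real $X$ they are taken in the complexification of $X$, that is, $m_B(\cos(\omega\,\cdot)f)=m_B(\sin(\omega\,\cdot)f)=0$.) -/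

import Mathlib

open Filter Topology MeasureTheory
open scoped BoundedContinuousFunction ZeroAtInfty ENNReal

universe u v

namespace AlmostPeriodic

/-- `J` is the half line `[0, ∞)` or the whole line `ℝ`. -/
def IsHalfLineOrLine (J : AddSubmonoid ℝ) : Prop :=
  J = AddSubmonoid.nonneg ℝ ∨ J = ⊤

/-- The translate `f_s(t) = f(s + t)`, for `s ∈ J`, of `f ∈ C_b(J, X)`. -/
noncomputable def shift {J : AddSubmonoid ℝ} {X : Type*} [NormedAddCommGroup X]
    (f : J →ᵇ X) (s : J) : J →ᵇ X :=
  f.compContinuous ⟨fun t => s + t, by fun_prop⟩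

/-- The orbit `O(f) = {f_s : s ∈ J}`, as a subset of `C_b(J, X)` with its weak topology. -/
noncomputable def weakOrbit (𝕜 : Type*) [RCLike 𝕜] {J : AddSubmonoid ℝ} {X : Type*}
    [NormedAddCommGroup X] [NormedSpace 𝕜 X] (f : J →ᵇ X) : Set (WeakSpace 𝕜 (J →ᵇ X)) :=
  Set.range fun s : J => toWeakSpace 𝕜 (J →ᵇ X) (shift f s)

/-- `EAP(J, X)`: the Eberlein almost periodic functions, whose orbit is relatively weakly compact
in `C_b(J, X)`. -/
def EAP (𝕜 : Type*) [RCLike 𝕜] (J : AddSubmonoid ℝ) (X : Type*)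
    [NormedAddCommGroup X] [NormedSpace 𝕜 X] : Set (J →ᵇ X) :=
  {f | IsCompact (closure (weakOrbit 𝕜 f))}

/-- `EAP₀(J, X)`: those `f ∈ EAP(J, X)` for which `0` is in the weak closure of the orbit. -/
def EAPZero (𝕜 : Type*) [RCLike 𝕜] (J : AddSubmonoid ℝ) (X : Type*)
    [NormedAddCommGroup X] [NormedSpace 𝕜 X] : Set (J →ᵇ X) :=
  {f | f ∈ EAP 𝕜 J X ∧ toWeakSpace 𝕜 (J →ᵇ X) 0 ∈ closure (weakOrbit 𝕜 f)}

/-- Bohr almost periodicity of `g : ℝ → X`: `g` is continuous and for every `ε > 0` the set of its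
`ε`-almost periods is relatively dense. -/
def IsBohrAP {X : Type*} [NormedAddCommGroup X] (g : ℝ → X) : Prop :=
  Continuous g ∧ ∀ ε : ℝ, 0 < ε → ∃ L : ℝ, 0 < L ∧ ∀ a : ℝ,
    ∃ τ ∈ Set.Icc a (a + L), ∀ t : ℝ, ‖g (t + τ) - g t‖ ≤ ε

/-- `AP(J, X)`: the restrictions to `J` of the almost periodic functions on `ℝ`
(which are automatically bounded). -/
def AP (J : AddSubmonoid ℝ) (X : Type*) [NormedAddCommGroup X] : Set (J →ᵇ X) :=
  {g | ∃ G : ℝ → X, IsBohrAP G ∧ ∀ t : J, g t = G t}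

/-- The mean of `u : J → E` exists and equals `x`: the averages of `u` over `J ∩ [-T, T]`
converge to `x` as `T → ∞` (with Lebesgue measure on `J`). These averages are `(1 / T) ∫_0^T u` for `J = [0, ∞)` and
`(1 / 2T) ∫_{-T}^T u` for `J = ℝ`. -/
def HasMean {J : AddSubmonoid ℝ} {E : Type*} [NormedAddCommGroup E] [NormedSpace ℝ E]
    (u : J → E) (x : E) : Prop :=
  Tendsto (fun T : ℝ => ⨍ t in {t : J | |(t : ℝ)| ≤ T}, u t ∂(Measure.comap Subtype.val volume)) atTop (𝓝 x)

/-- `PAP₀(J, X)`: those `f ∈ C_b(J, X)` for which the mean of `‖f‖` exists and is `0`. -/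
def PAPZero (J : AddSubmonoid ℝ) (X : Type*) [NormedAddCommGroup X] : Set (J →ᵇ X) :=
  {f | HasMean (fun t => ‖f t‖) 0}

/-- `PAP(J, X)`: the pseudo almost periodic functions, sums of a function in `AP(J, X)`
and a function in `PAP₀(J, X)`. -/
def PAP (J : AddSubmonoid ℝ) (X : Type*) [NormedAddCommGroup X] : Set (J →ᵇ X) :=
  {f | ∃ g ∈ AP J X, ∃ h ∈ PAPZero J X, f = g + h}

/-- For a complex space `X`, the Fourier coefficient of `f` at the frequency `ω`, the mean of
`t ↦ e^{-iωt} f(t)`, exists and equals `x`. -/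
def HasFourierCoeff {J : AddSubmonoid ℝ} {X : Type*} [NormedAddCommGroup X] [NormedSpace ℂ X]
    (f : J →ᵇ X) (ω : ℝ) (x : X) : Prop :=
  HasMean (fun t : J => Complex.exp (-(Complex.I * (ω * (t : ℝ) : ℝ))) • f t) x

/-- For a real space `X`, the Fourier coefficient of `f` at the frequency `ω`, an element
`a - i b` of the complexification of `X`: here `a` and `b` are the means of
`t ↦ cos(ωt) f(t)` and `t ↦ sin(ωt) f(t)`. -/
def HasRealFourierCoeff {J : AddSubmonoid ℝ} {X : Type*} [NormedAddCommGroup X] [NormedSpace ℝ X]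
    (f : J →ᵇ X) (ω : ℝ) (a b : X) : Prop :=
  HasMean (fun t : J => Real.cos (ω * t) • f t) a ∧
    HasMean (fun t : J => Real.sin (ω * t) • f t) b

/-- `EAP(J, X)` is not contained in `PAP(J, X)`, and this is witnessed by a function in
`EAP₀(J, X)` for which neither the mean of `‖f‖` nor the mean of `‖f‖²` exists. -/
def InclusionFails (𝕜 : Type*) [RCLike 𝕜] (J : AddSubmonoid ℝ) (X : Type*)
    [NormedAddCommGroup X] [NormedSpace 𝕜 X] : Prop :=
  ¬ EAP 𝕜 J X ⊆ PAP J X ∧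
    ∃ f ∈ EAPZero 𝕜 J X,
      (¬ ∃ m : ℝ, HasMean (fun t => ‖f t‖) m) ∧
      (¬ ∃ m : ℝ, HasMean (fun t => ‖f t‖ ^ 2) m) ∧
      f ∉ PAP J X

end AlmostPeriodic

/-! Vanishing means. If `0` is a weak limit of translates of `F`, Mazur's argument puts `0` in the
norm closure of their convex hull. Translation does not change averages asymptotically, so `F` has
averages asymptotic to those of functions of arbitrarily small norm, and its mean is `0`
(`hasMean_zero_of_tendsto`). The hypothesis survives multiplication by a scalar almost periodic `k`,
whose translates are totally bounded (`tendsto_shift_mulLeft`). Taking sines and cosines for `k`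
gives the Fourier coefficients. If `f = g + h`, then with `k = φ ∘ g` the function `k² = k · φ(f) -
k · φ(h)` has mean `0`, which forces the almost periodic `k` to vanish.

Counterexamples. On `[n, n + 1]` let `f` be a sine arch in the direction of a unit vector `e n`,
switched on only for `n` in the blocks `[4^k, 2 * 4^k)`. At any point, `N` translates of `f` by
separated amounts involve distinct `e n`, so their signed sum has norm `o(N)` whenever sums of `N`
vectors `e n` do. A functional therefore cannot stay away from `0` on an unbounded set of
translates: the orbit tends weakly to `0` at infinity (`tendsto_apply_shift_waveOn`). The averages
of `‖f‖` and `‖f‖²` oscillate because of the long gaps, and a function in `EAP₀` without a mean of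
its norm is not in `PAP`. -/

namespace AlmostPeriodic

/-! ### Averages over `J` as interval integrals -/

open Classical in
/-- The averages over `J` are averages over the intervals `[-(leftFactor J) T, T]`. -/
noncomputable def leftFactor (J : AddSubmonoid ℝ) : ℝ := if J = ⊤ then 1 else 0

lemma leftFactor_nonneg (J : AddSubmonoid ℝ) : 0 ≤ leftFactor J := by
  unfold leftFactor; split_ifs <;> norm_num

lemma leftFactor_le_one (J : AddSubmonoid ℝ) : leftFactor J ≤ 1 := by
  unfold leftFactor; split_ifs <;> norm_num

variable {J : AddSubmonoid ℝ}

lemma leftFactor_top : leftFactor (⊤ : AddSubmonoid ℝ) = 1 := by simp [leftFactor]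

lemma leftFactor_halfLine : leftFactor (AddSubmonoid.nonneg ℝ) = 0 := by
  have : (AddSubmonoid.nonneg ℝ) ≠ ⊤ := fun h => by
    have h1 : (-1 : ℝ) ∈ AddSubmonoid.nonneg ℝ := h ▸ AddSubmonoid.mem_top _
    rw [AddSubmonoid.mem_nonneg] at h1
    linarith
  simp [leftFactor, this]

lemma IsHalfLineOrLine.mem_of_nonneg (hJ : IsHalfLineOrLine J) {t : ℝ} (ht : 0 ≤ t) : t ∈ J := by
  rcases hJ with rfl | rfl
  · simpa using ht
  · simp

lemma IsHalfLineOrLine.Icc_inter (hJ : IsHalfLineOrLine J) {T : ℝ} (hT : 0 ≤ T) :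
    Set.Icc (-T) T ∩ J = Set.Icc (-(leftFactor J * T)) T := by
  rcases hJ with rfl | rfl
  · ext t
    simp only [leftFactor_halfLine, Set.mem_inter_iff, Set.mem_Icc, SetLike.mem_coe,
      AddSubmonoid.mem_nonneg, zero_mul, neg_zero]
    constructor
    · rintro ⟨⟨_, h⟩, h'⟩; exact ⟨h', h⟩
    · rintro ⟨h', h⟩; exact ⟨⟨by linarith, h⟩, h'⟩
  · simp [leftFactor_top]

lemma IsHalfLineOrLine.isClosed (hJ : IsHalfLineOrLine J) : IsClosed (J : Set ℝ) := by
  rcases hJ with rfl | rfl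
  · exact isClosed_Ici (a := (0 : ℝ))
  · simp

/-- A continuous retraction of the line onto `J`. -/
lemma IsHalfLineOrLine.exists_retraction (hJ : IsHalfLineOrLine J) :
    ∃ r : C(ℝ, J), ∀ t : J, r t = t := by
  rcases hJ with rfl | rfl
  · refine ⟨⟨fun t => ⟨max t 0, by simp⟩, by fun_prop⟩, fun t => ?_⟩
    have := t.2
    rw [AddSubmonoid.mem_nonneg] at this
    ext
    simp [this]
  · exact ⟨⟨fun t => ⟨t, by simp⟩, by fun_prop⟩, fun t => rfl⟩

/-- The average of `U : ℝ → E` over `J ∩ [-T, T]`. -/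
noncomputable def intervalMean (J : AddSubmonoid ℝ) {E : Type*} [NormedAddCommGroup E]
    [NormedSpace ℝ E] (U : ℝ → E) (T : ℝ) : E :=
  ((1 + leftFactor J) * T)⁻¹ • ∫ t in (-(leftFactor J * T))..T, U t

section IntervalMean

variable {E : Type*} [NormedAddCommGroup E] [NormedSpace ℝ E]

lemma neg_leftFactor_mul_le {T : ℝ} (hT : 0 ≤ T) : -(leftFactor J * T) ≤ T := by
  nlinarith [mul_nonneg (leftFactor_nonneg J) hT]

lemma setAverage_eq_intervalMean (hJ : IsHalfLineOrLine J) (U : ℝ → E) {T : ℝ} (hT : 0 ≤ T) :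
    ⨍ t in {t : J | |(t : ℝ)| ≤ T}, U t ∂(Measure.comap Subtype.val volume)
      = intervalMean J U T := by
  have hm : MeasurableSet (J : Set ℝ) := hJ.isClosed.measurableSet
  have hs : {t : J | |(t : ℝ)| ≤ T} = Subtype.val ⁻¹' Set.Icc (-T) T := by
    ext t; simp [abs_le]
  have he : MeasurableEmbedding (Subtype.val : J → ℝ) := MeasurableEmbedding.subtype_coe hm
  have hmap : (Measure.comap (Subtype.val : J → ℝ) volume).map Subtype.val
      = volume.restrict (J : Set ℝ) := map_comap_subtype_coe hm volume
  have hle := neg_leftFactor_mul_le (J := J) hT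
  rw [setAverage_eq, hs, ← he.setIntegral_map, hmap, measureReal_def,
    ← he.map_apply, hmap, Measure.restrict_apply measurableSet_Icc,
    Measure.restrict_restrict measurableSet_Icc, hJ.Icc_inter hT, Real.volume_Icc,
    ENNReal.toReal_ofReal (by linarith), integral_Icc_eq_integral_Ioc,
    ← intervalIntegral.integral_of_le hle, intervalMean]
  congr 2
  ring

/-- Any extension `U` will do, since for `T ≥ 0` the interval of integration lies in `J`; the
retraction onto `J` provides continuous extensions. -/
lemma hasMean_iff (hJ : IsHalfLineOrLine J) {u : J → E} {U : ℝ → E} (h : ∀ t : J, u t = U t)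
    (x : E) : HasMean u x ↔ Tendsto (intervalMean J U) atTop (𝓝 x) := by
  unfold HasMean
  refine tendsto_congr' ?_
  filter_upwards [eventually_ge_atTop 0] with T hT
  rw [← setAverage_eq_intervalMean hJ U hT]
  simp_rw [h]

lemma intervalMean_add {U V : ℝ → E} (hU : Continuous U) (hV : Continuous V) (T : ℝ) :
    intervalMean J (fun t => U t + V t) T = intervalMean J U T + intervalMean J V T := by
  simp only [intervalMean]
  rw [intervalIntegral.integral_add (hU.intervalIntegrable _ _) (hV.intervalIntegrable _ _),
    smul_add]

lemma intervalMean_smul (c : ℝ) (U : ℝ → E) (T : ℝ) :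
    intervalMean J (fun t => c • U t) T = c • intervalMean J U T := by
  simp only [intervalMean]
  rw [intervalIntegral.integral_smul, smul_comm]

lemma intervalMean_scale_nonneg {T : ℝ} (hT : 0 ≤ T) : 0 ≤ ((1 + leftFactor J) * T)⁻¹ :=
  inv_nonneg.2 (mul_nonneg (by linarith [leftFactor_nonneg J]) hT)

lemma norm_intervalMean_le {U : ℝ → E} {V : ℝ → ℝ} (hV : Continuous V)
    (h : ∀ t, ‖U t‖ ≤ V t) {T : ℝ} (hT : 0 ≤ T) :
    ‖intervalMean J U T‖ ≤ intervalMean J V T := by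
  simp only [intervalMean]
  rw [norm_smul, Real.norm_of_nonneg (intervalMean_scale_nonneg hT), smul_eq_mul]
  exact mul_le_mul_of_nonneg_left
    (intervalIntegral.norm_integral_le_of_norm_le (neg_leftFactor_mul_le hT)
      (ae_of_all _ fun t _ => h t) (hV.intervalIntegrable _ _)) (intervalMean_scale_nonneg hT)

lemma intervalMean_const {T : ℝ} (hT : 0 < T) (c : ℝ) : intervalMean J (fun _ => c) T = c := by
  have := leftFactor_nonneg J
  have h : (1 + leftFactor J) * T ≠ 0 := by positivity
  simp only [intervalMean, intervalIntegral.integral_const, smul_eq_mul]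
  field_simp
  ring

/-- Shifting the interval by `s` alters the integral only on two end pieces of length `|s|`, while
the normalizing length is at least `T`. -/
lemma tendsto_intervalMean_translate_sub {U : ℝ → E} (hU : Continuous U) {C : ℝ}
    (hC : ∀ t, ‖U t‖ ≤ C) (s : ℝ) :
    Tendsto (fun T => intervalMean J (fun t => U (s + t)) T - intervalMean J U T) atTop (𝓝 0) := by
  have hC0 : 0 ≤ C := (norm_nonneg _).trans (hC 0)
  have key : ∀ T : ℝ, 0 < T →
      ‖intervalMean J (fun t => U (s + t)) T - intervalMean J U T‖ ≤ T⁻¹ * (2 * (C * |s|)) := by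
    intro T hT
    have hi : ∀ a b, IntervalIntegrable U volume a b := fun a b => hU.intervalIntegrable a b
    have hb : ∀ a, ‖∫ t in a..(s + a), U t‖ ≤ C * |s| := fun a => by
      have := intervalIntegral.norm_integral_le_of_norm_le_const (a := a) (b := s + a) (f := U)
        (fun x _ => hC x)
      simpa using this
    simp only [intervalMean]
    rw [← smul_sub, intervalIntegral.integral_comp_add_left, norm_smul,
      Real.norm_of_nonneg (intervalMean_scale_nonneg hT.le)]
    set a := -(leftFactor J * T)
    have : (∫ t in (s + a)..(s + T), U t) - ∫ t in a..T, U t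
        = (∫ t in T..(s + T), U t) - ∫ t in a..(s + a), U t := by
      have h1 := intervalIntegral.integral_add_adjacent_intervals (hi a (s + a)) (hi _ (s + T))
      have h2 := intervalIntegral.integral_add_adjacent_intervals (hi a T) (hi _ (s + T))
      rw [sub_eq_sub_iff_add_eq_add, add_comm, h1, ← h2, add_comm]
    rw [this]
    gcongr
    · have := leftFactor_nonneg J
      nlinarith
    · exact (norm_sub_le _ _).trans (by linarith [hb T, hb a])
  refine squeeze_zero_norm' ?_ (a := fun T : ℝ => T⁻¹ * (2 * (C * |s|))) ?_
  · filter_upwards [eventually_gt_atTop 0] with T hT using key T hT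
  · simpa using tendsto_inv_atTop_zero.mul_const (2 * (C * |s|))

end IntervalMean

end AlmostPeriodic

/-! ### Weakly null translates force mean zero -/

namespace AlmostPeriodic

variable {J : AddSubmonoid ℝ}

@[simp] lemma shift_apply {X : Type*} [NormedAddCommGroup X] (f : J →ᵇ X) (s t : J) :
    shift f s t = f (s + t) := rfl

lemma norm_shift_le {X : Type*} [NormedAddCommGroup X] (f : J →ᵇ X) (s : J) :
    ‖shift f s‖ ≤ ‖f‖ :=
  (BoundedContinuousFunction.norm_le (norm_nonneg _)).2 fun _ => f.norm_coe_le_norm _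

/-- If `0` is in the weak closure of the orbit of `f`, then the translates of `f` tend weakly to `0`
along some filter, also with respect to real functionals. -/
lemma exists_filter_of_mem_closure {𝕜 : Type*} [RCLike 𝕜] {X : Type*} [NormedAddCommGroup X]
    [NormedSpace 𝕜 X] [NormedSpace ℝ X] [IsScalarTower ℝ 𝕜 X] {f : J →ᵇ X}
    (hf : toWeakSpace 𝕜 (J →ᵇ X) 0 ∈ closure (weakOrbit 𝕜 f)) :
    ∃ l : Filter J, l.NeBot ∧
      ∀ Φ : (J →ᵇ X) →L[ℝ] ℝ, Tendsto (fun s => Φ (shift f s)) l (𝓝 0) := by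
  set γ : J → WeakSpace 𝕜 (J →ᵇ X) := fun s => toWeakSpace 𝕜 (J →ᵇ X) (shift f s) with hγ
  refine ⟨comap γ (𝓝 (toWeakSpace 𝕜 (J →ᵇ X) 0)), ?_, fun Φ => ?_⟩
  · rw [comap_neBot_iff_frequently]
    exact mem_closure_iff_frequently.1 hf
  · have : IsScalarTower ℝ 𝕜 (J →ᵇ X) := ⟨fun a b F => by
      ext t; exact smul_assoc a b (F t)⟩
    -- Every real functional is the real part of a `𝕜`-linear one, so weak convergence over `𝕜`
    -- suffices.
    set Ψ : StrongDual 𝕜 (J →ᵇ X) := StrongDual.extendRCLike Φ with hΨ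
    have hev : Continuous fun x : WeakSpace 𝕜 (J →ᵇ X) =>
        RCLike.re (topDualPairing 𝕜 (J →ᵇ X) Ψ ((toWeakSpace 𝕜 (J →ᵇ X)).symm x)) :=
      RCLike.continuous_re.comp (WeakBilin.eval_continuous (topDualPairing 𝕜 (J →ᵇ X)).flip Ψ)
    have h1 := (hev.tendsto (toWeakSpace 𝕜 (J →ᵇ X) 0)).comp
      (tendsto_comap (f := γ) (x := 𝓝 (toWeakSpace 𝕜 (J →ᵇ X) 0)))
    have h2 : ∀ F : J →ᵇ X, RCLike.re (Ψ F) = Φ F := fun F => by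
      rw [hΨ, StrongDual.extendRCLike_apply]; simp
    simpa [Function.comp_def, hγ, h2, topDualPairing_apply] using h1

variable {X : Type*} [NormedAddCommGroup X] [NormedSpace ℝ X]

/-- If the translates of `F` tend weakly to `0` along some filter, then `F` has mean `0`. -/
lemma hasMean_zero_of_tendsto (hJ : IsHalfLineOrLine J) {F : J →ᵇ X} {l : Filter J} [l.NeBot]
    (hl : ∀ Φ : (J →ᵇ X) →L[ℝ] ℝ, Tendsto (fun s => Φ (shift F s)) l (𝓝 0)) :
    HasMean F 0 := by
  obtain ⟨r, hr⟩ := hJ.exists_retraction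
  have hc : ∀ G : J →ᵇ X, Continuous fun t => G (r t) := fun G => G.continuous.comp r.continuous
  rw [hasMean_iff hJ (U := fun t => F (r t)) (fun t => by rw [hr])]
  set A : (J →ᵇ X) → ℝ → X := fun G => intervalMean J fun t => G (r t) with hA
  -- Functions whose averages are asymptotic to those of `F`: a convex set containing the orbit,
  -- hence its convex hull.
  set C : Set (J →ᵇ X) := {G | Tendsto (fun T => A G T - A F T) atTop (𝓝 0)} with hC
  have hconv : Convex ℝ C := by
    intro G hG H hH a b ha hb hab
    have h := (hG.const_smul a).add (hH.const_smul b)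
    simp only [smul_zero, add_zero] at h
    refine h.congr fun T => ?_
    have h1 : A (a • G + b • H) T = a • A G T + b • A H T := by
      simp only [hA, BoundedContinuousFunction.coe_add, BoundedContinuousFunction.coe_smul,
        Pi.add_apply]
      rw [intervalMean_add (U := fun t => a • G (r t)) (V := fun t => b • H (r t))
        ((hc G).const_smul a) ((hc H).const_smul b), intervalMean_smul,
        intervalMean_smul]
    have h2 : A F T = a • A F T + b • A F T := by rw [← add_smul, hab, one_smul]
    rw [h1]
    nth_rw 3 [h2]
    simp only [smul_sub]
    abel
  have hsub : Set.range (shift F) ⊆ C := by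
    rintro _ ⟨s, rfl⟩
    refine (tendsto_intervalMean_translate_sub (J := J) (hc F) (fun t => F.norm_coe_le_norm _) s).congr' ?_
    filter_upwards [eventually_ge_atTop 0] with T hT
    congr 1
    simp only [hA, intervalMean]
    congr 1
    -- The retraction commutes with translation only on `J`, and the interval of integration stays
    -- inside `J`.
    refine intervalIntegral.integral_congr fun t ht => ?_
    rw [Set.uIcc_of_le (neg_leftFactor_mul_le hT), ← hJ.Icc_inter hT] at ht
    have h1 := hr ⟨t, ht.2⟩
    have h2 := hr (s + ⟨t, ht.2⟩)
    simp only [AddSubmonoid.coe_add] at h1 h2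
    simp [h1, h2]
  -- Otherwise Hahn–Banach gives `Φ` with `Φ (shift F s) ≥ u > 0` for all `s`, contrary to the limit
  -- `0`.
  have h0 : (0 : J →ᵇ X) ∈ closure (convexHull ℝ (Set.range (shift F))) := by
    by_contra h
    obtain ⟨Φ, u, hu, hΦ⟩ := geometric_hahn_banach_point_closed
      (convex_convexHull ℝ _).closure isClosed_closure h
    rw [map_zero] at hu
    have h1 : ∀ s, u ≤ Φ (shift F s) := fun s =>
      (hΦ _ (subset_closure (subset_convexHull ℝ _ ⟨s, rfl⟩))).le
    exact absurd (ge_of_tendsto' (hl Φ) h1) (not_le.2 hu)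
  rw [Metric.tendsto_nhds]
  intro ε hε
  obtain ⟨G, hG, hGε⟩ := Metric.mem_closure_iff.1 h0 (ε / 2) (half_pos hε)
  have hGC : G ∈ C := convexHull_min hsub hconv hG
  rw [dist_zero_left] at hGε
  filter_upwards [Metric.tendsto_nhds.1 hGC (ε / 2) (half_pos hε), eventually_gt_atTop 0]
    with T h1 hT
  rw [dist_zero_right] at h1 ⊢
  have h2 : ‖A G T‖ ≤ ‖G‖ := by
    have := norm_intervalMean_le (J := J) (U := fun t => G (r t)) (V := fun _ => ‖G‖)
      continuous_const (fun t => G.norm_coe_le_norm _) hT.le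
    rwa [intervalMean_const hT] at this
  calc ‖A F T‖ = ‖A G T - (A G T - A F T)‖ := by rw [sub_sub_cancel]
    _ ≤ ‖A G T‖ + ‖A G T - A F T‖ := norm_sub_le _ _
    _ < ε := by linarith

end AlmostPeriodic

/-! ### Bohr almost periodic functions and their use as multipliers -/

namespace AlmostPeriodic

section Bohr

variable {X : Type*} [NormedAddCommGroup X] {G : ℝ → X}

/-- An almost period moves `s` into `[0, L]` and a nearby `t` into `[-1, L + 1]`, where Heine–Cantor
applies. -/
lemma IsBohrAP.uniformContinuity (hG : IsBohrAP G) {ε : ℝ} (hε : 0 < ε) :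
    ∃ δ > 0, ∀ s t : ℝ, |s - t| < δ → ‖G s - G t‖ ≤ ε := by
  obtain ⟨L, hL, hτ⟩ := hG.2 (ε / 3) (by positivity)
  have huc := isCompact_Icc (a := (-1 : ℝ)) (b := L + 1) |>.uniformContinuousOn_of_continuous
    hG.1.continuousOn
  obtain ⟨δ, hδ, h⟩ := Metric.uniformContinuousOn_iff.1 huc (ε / 3) (by positivity)
  refine ⟨min δ 1, by positivity, fun s t hst => ?_⟩
  obtain ⟨τ, ⟨h1, h2⟩, h3⟩ := hτ (-s)
  have hst1 := abs_lt.1 (hst.trans_le (min_le_right _ _))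
  have hd : dist (s + τ) (t + τ) < δ := by
    rw [Real.dist_eq, add_sub_add_right_eq_sub]; exact hst.trans_le (min_le_left _ _)
  have h4 := h (s + τ) ⟨by linarith, by linarith⟩ (t + τ) ⟨by linarith, by linarith⟩ hd
  rw [dist_eq_norm] at h4
  calc ‖G s - G t‖ = ‖-(G (s + τ) - G s) + (G (s + τ) - G (t + τ)) + (G (t + τ) - G t)‖ := by
        congr 1; abel
    _ ≤ ‖-(G (s + τ) - G s)‖ + ‖G (s + τ) - G (t + τ)‖ + ‖G (t + τ) - G t‖ := norm_add₃_le
    _ ≤ ε := by rw [norm_neg]; linarith [h3 s, h3 t]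

/-- The translates of an almost periodic function form a totally bounded set. -/
lemma IsBohrAP.exists_finite_net (hG : IsBohrAP G) {ε : ℝ} (hε : 0 < ε) :
    ∃ R : Finset ℝ, (∀ r ∈ R, 0 ≤ r) ∧ ∀ s, ∃ r ∈ R, ∀ t, ‖G (s + t) - G (r + t)‖ ≤ ε := by
  obtain ⟨δ, hδ, hδG⟩ := hG.uniformContinuity (half_pos hε)
  obtain ⟨L, hL, hτ⟩ := hG.2 (ε / 2) (half_pos hε)
  -- The net is the grid of step `δ / 2` in `[0, L]`: move `s` into `[0, L]` by an almost period and
  -- round down. Its points are nonnegative, so they lie in either `J`.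
  refine ⟨(Finset.range (⌊L / (δ / 2)⌋₊ + 1)).image fun i : ℕ => i * (δ / 2), ?_, fun s => ?_⟩
  · intro r hr
    obtain ⟨i, -, rfl⟩ := Finset.mem_image.1 hr
    positivity
  · obtain ⟨τ, ⟨h1, h2⟩, h3⟩ := hτ (-s)
    have h0 : 0 ≤ (s + τ) / (δ / 2) := by apply div_nonneg <;> linarith
    have hle := Nat.floor_le h0
    have hlt := Nat.lt_floor_add_one ((s + τ) / (δ / 2))
    rw [le_div_iff₀ (by positivity)] at hle
    rw [div_lt_iff₀ (by positivity)] at hlt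
    refine ⟨⌊(s + τ) / (δ / 2)⌋₊ * (δ / 2), Finset.mem_image.2 ⟨_, Finset.mem_range.2 ?_, rfl⟩,
      fun t => ?_⟩
    · rw [Nat.lt_add_one_iff]
      gcongr
      linarith
    · have h4 := hδG (s + t + τ) (⌊(s + τ) / (δ / 2)⌋₊ * (δ / 2) + t)
        (by rw [abs_lt]; constructor <;> linarith)
      have h5 := h3 (s + t)
      calc _ = ‖-(G (s + t + τ) - G (s + t)) +
              (G (s + t + τ) - G (⌊(s + τ) / (δ / 2)⌋₊ * (δ / 2) + t))‖ := by
            congr 1; abel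
        _ ≤ _ := norm_add_le _ _
        _ ≤ ε := by rw [norm_neg]; linarith

lemma IsBohrAP.of_periodic (hG : Continuous G) {c : ℝ} (hc : 0 < c)
    (h : Function.Periodic G c) : IsBohrAP G := by
  refine ⟨hG, fun ε hε => ⟨c, hc, fun a => ?_⟩⟩
  obtain ⟨n, hn, -⟩ := existsUnique_add_zsmul_mem_Ico hc (0 : ℝ) a
  rw [zero_add] at hn
  refine ⟨n • c, ⟨hn.1, hn.2.le⟩, fun t => ?_⟩
  rw [h.zsmul n t, sub_self, norm_zero]
  exact hε.le

lemma IsBohrAP.clm_comp [NormedSpace ℝ X] (hG : IsBohrAP G) (φ : X →L[ℝ] ℝ) :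
    IsBohrAP fun t => φ (G t) := by
  refine ⟨φ.continuous.comp hG.1, fun ε hε => ?_⟩
  obtain ⟨L, hL, h⟩ := hG.2 (ε / (‖φ‖ + 1)) (by positivity)
  refine ⟨L, hL, fun a => ?_⟩
  obtain ⟨τ, hτ, h1⟩ := h a
  refine ⟨τ, hτ, fun t => ?_⟩
  rw [← map_sub]
  calc _ ≤ ‖φ‖ * ‖G (t + τ) - G t‖ := φ.le_opNorm _
    _ ≤ (‖φ‖ + 1) * (ε / (‖φ‖ + 1)) := by gcongr; linarith; exact h1 t
    _ = ε := by field_simp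

lemma isBohrAP_cos (ω : ℝ) : IsBohrAP fun t => Real.cos (ω * t) := by
  rcases eq_or_ne ω 0 with rfl | hω
  · exact .of_periodic (by fun_prop) one_pos fun t => by simp
  · refine .of_periodic (by fun_prop) (c := 2 * Real.pi / |ω|) (by positivity) fun t => ?_
    rcases abs_cases ω with ⟨h, -⟩ | ⟨h, -⟩ <;> rw [h]
    · rw [mul_add, mul_div_cancel₀ _ hω, Real.cos_add_two_pi]
    · rw [mul_add, div_neg, mul_neg, mul_div_cancel₀ _ hω, ← sub_eq_add_neg, Real.cos_sub_two_pi]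

lemma isBohrAP_sin (ω : ℝ) : IsBohrAP fun t => Real.sin (ω * t) := by
  rcases eq_or_ne ω 0 with rfl | hω
  · exact .of_periodic (by fun_prop) one_pos fun t => by simp
  · refine .of_periodic (by fun_prop) (c := 2 * Real.pi / |ω|) (by positivity) fun t => ?_
    rcases abs_cases ω with ⟨h, -⟩ | ⟨h, -⟩ <;> rw [h]
    · rw [mul_add, mul_div_cancel₀ _ hω, Real.sin_add_two_pi]
    · rw [mul_add, div_neg, mul_neg, mul_div_cancel₀ _ hω, ← sub_eq_add_neg, Real.sin_sub_two_pi]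

end Bohr

variable {J : AddSubmonoid ℝ} {X : Type*} [NormedAddCommGroup X] [NormedSpace ℝ X]

/-- Multiplication of bounded continuous functions by a fixed scalar one. -/
noncomputable def mulLeft (k : J →ᵇ ℝ) : (J →ᵇ X) →L[ℝ] (J →ᵇ X) :=
  LinearMap.mkContinuous
    { toFun := fun F => k • F
      map_add' := fun F G => by ext t; exact smul_add (k t) (F t) (G t)
      map_smul' := fun c F => by ext t; exact smul_comm (k t) c (F t) } ‖k‖
    fun F => norm_smul_le k F

@[simp] lemma mulLeft_apply (k : J →ᵇ ℝ) (F : J →ᵇ X) (t : J) : mulLeft k F t = k t • F t := rfl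

lemma norm_mulLeft_apply_le (k : J →ᵇ ℝ) (F : J →ᵇ X) : ‖mulLeft k F‖ ≤ ‖k‖ * ‖F‖ :=
  norm_smul_le k F

/-- A translate of `k f` is the product of the translates of `k` and `f`. The former is uniformly
close to one of finitely many fixed translates, and multiplication by a fixed function followed by
`Φ` is again a functional. -/
lemma tendsto_shift_mulLeft (hJ : IsHalfLineOrLine J) {k : J →ᵇ ℝ} (hk : k ∈ AP J ℝ)
    {f : J →ᵇ X} {l : Filter J}
    (hl : ∀ Φ : (J →ᵇ X) →L[ℝ] ℝ, Tendsto (fun s => Φ (shift f s)) l (𝓝 0))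
    (Φ : (J →ᵇ X) →L[ℝ] ℝ) : Tendsto (fun s => Φ (shift (mulLeft k f) s)) l (𝓝 0) := by
  obtain ⟨K, hK, hKk⟩ := hk
  rw [Metric.tendsto_nhds]
  intro ε hε
  obtain ⟨R, hR0, hR⟩ := hK.exists_finite_net (ε := ε / 2 / (‖Φ‖ * ‖f‖ + 1)) (by positivity)
  have hev : ∀ᶠ s in l, ∀ r : R,
      |Φ (mulLeft (shift k ⟨r, hJ.mem_of_nonneg (hR0 r r.2)⟩) (shift f s))| < ε / 2 := by
    refine eventually_all.2 fun r => ?_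
    have := Metric.tendsto_nhds.1
      (hl (Φ.comp (mulLeft (shift k ⟨r, hJ.mem_of_nonneg (hR0 r r.2)⟩)))) (ε / 2) (half_pos hε)
    simpa [Real.dist_eq] using this
  filter_upwards [hev] with s hs
  obtain ⟨r, hr, hrs⟩ := hR s
  have h1 := hs ⟨r, hr⟩
  set q : J := ⟨r, hJ.mem_of_nonneg (hR0 r hr)⟩
  have h2 : shift (mulLeft k f) s
      = mulLeft (shift k s - shift k q) (shift f s) + mulLeft (shift k q) (shift f s) := by
    ext t; simp [sub_smul]
  have h3 : ‖shift k s - shift k q‖ ≤ ε / 2 / (‖Φ‖ * ‖f‖ + 1) := by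
    refine (BoundedContinuousFunction.norm_le (by positivity)).2 fun t => ?_
    simpa [hKk, q] using hrs t
  have h4 : |Φ (mulLeft (shift k s - shift k q) (shift f s))| ≤ ε / 2 := by
    calc _ ≤ ‖Φ‖ * ‖mulLeft (shift k s - shift k q) (shift f s)‖ := Φ.le_opNorm _
      _ ≤ ‖Φ‖ * ((ε / 2 / (‖Φ‖ * ‖f‖ + 1)) * ‖f‖) := by
          gcongr
          exact (norm_mulLeft_apply_le _ _).trans
            (mul_le_mul h3 (norm_shift_le f s) (norm_nonneg _) (by positivity))
      _ = (ε / 2) * ((‖Φ‖ * ‖f‖) / (‖Φ‖ * ‖f‖ + 1)) := by ring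
      _ ≤ (ε / 2) * 1 := by
          gcongr
          exact div_le_one_of_le₀ (by linarith) (by positivity)
      _ = ε / 2 := mul_one _
  rw [Real.dist_eq, sub_zero, h2, map_add]
  exact (abs_add_le _ _).trans_lt (by simp only [q] at h4 ⊢; linarith)

/-- Products of a function with weakly null translates and an almost periodic function have
mean `0`. -/
lemma hasMean_smul_of_tendsto (hJ : IsHalfLineOrLine J) {k : J →ᵇ ℝ} (hk : k ∈ AP J ℝ)
    {f : J →ᵇ X} {l : Filter J} [l.NeBot]
    (hl : ∀ Φ : (J →ᵇ X) →L[ℝ] ℝ, Tendsto (fun s => Φ (shift f s)) l (𝓝 0)) :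
    HasMean (fun t => k t • f t) 0 :=
  hasMean_zero_of_tendsto (F := mulLeft k f) hJ (tendsto_shift_mulLeft hJ hk hl)

lemma HasMean.of_norm_le (hJ : IsHalfLineOrLine J) {u : J → X} {h : J → ℝ}
    (hh : Continuous h) (hmean : HasMean h 0) {C : ℝ} (hu : ∀ t, ‖u t‖ ≤ C * h t) :
    HasMean u 0 := by
  obtain ⟨r, hr⟩ := hJ.exists_retraction
  rw [hasMean_iff hJ (U := fun t => u (r t)) (fun t => by rw [hr])]
  rw [hasMean_iff hJ (U := fun t => h (r t)) (fun t => by rw [hr])] at hmean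
  have h1 := hmean.const_smul C
  rw [smul_zero] at h1
  refine squeeze_zero_norm' ?_ h1
  filter_upwards [eventually_ge_atTop 0] with T hT
  rw [← intervalMean_smul]
  exact norm_intervalMean_le ((hh.comp r.continuous).const_smul C) (fun t => hu (r t)) hT

lemma HasMean.add (hJ : IsHalfLineOrLine J) {u v : J → X} (hu : Continuous u) (hv : Continuous v)
    {x y : X} (hux : HasMean u x) (hvy : HasMean v y) : HasMean (fun t => u t + v t) (x + y) := by
  obtain ⟨r, hr⟩ := hJ.exists_retraction
  rw [hasMean_iff hJ (U := fun t => u (r t)) (fun t => by rw [hr])] at hux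
  rw [hasMean_iff hJ (U := fun t => v (r t)) (fun t => by rw [hr])] at hvy
  rw [hasMean_iff hJ (U := fun t => u (r t) + v (r t)) (fun t => by rw [hr])]
  refine (hux.add hvy).congr fun T => ?_
  exact (intervalMean_add (hu.comp r.continuous) (hv.comp r.continuous) T).symm

end AlmostPeriodic

/-! ### Vanishing of the almost periodic part and of the Fourier coefficients -/

namespace AlmostPeriodic

variable {J : AddSubmonoid ℝ}

/-- The mean square of a nonzero almost periodic function is not zero. -/
lemma IsBohrAP.not_tendsto_intervalMean_sq {K : ℝ → ℝ} (hK : IsBohrAP K) {t₀ : ℝ}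
    (h0 : K t₀ ≠ 0) : ¬ Tendsto (intervalMean J fun t => K t ^ 2) atTop (𝓝 0) := by
  intro hlim
  have hc : Continuous fun t => K t ^ 2 := hK.1.pow 2
  have hi : ∀ a b, IntervalIntegrable (fun t => K t ^ 2) volume a b :=
    fun a b => hc.intervalIntegrable a b
  set c := ∫ t in t₀..(t₀ + 1), K t ^ 2 with hcdef
  have hcpos : 0 < c := intervalIntegral.integral_pos (by linarith) hc.continuousOn
    (fun _ _ => sq_nonneg _) ⟨t₀, ⟨le_rfl, by linarith⟩, by positivity⟩
  obtain ⟨L, hL, hτ⟩ := hK.2 (Real.sqrt (c / 4)) (by positivity)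
  have hmono : ∀ {a b a' b' : ℝ}, a' ≤ a → a ≤ b → b ≤ b' →
      ∫ t in a..b, K t ^ 2 ≤ ∫ t in a'..b', K t ^ 2 := fun h1 h2 h3 =>
    intervalIntegral.integral_mono_interval h1 h2 h3 (ae_of_all _ fun _ => sq_nonneg _) (hi _ _)
  -- Each window of length `L + 1` contains a copy of `[t₀, t₀ + 1]` moved by an almost period.
  -- There `x² ≥ y² / 2 - (x - y)²` leaves at least `c / 2 - c / 4`.
  have hblock : ∀ a : ℝ, c / 4 ≤ ∫ t in a..(a + (L + 1)), K t ^ 2 := by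
    intro a
    obtain ⟨τ, ⟨h1, h2⟩, h3⟩ := hτ (a - t₀)
    have hle : ∀ t, K t ^ 2 / 2 - c / 4 ≤ K (t + τ) ^ 2 := fun t => by
      have h4 : (K (t + τ) - K t) ^ 2 ≤ c / 4 := by
        have h5 := h3 t
        rw [Real.norm_eq_abs] at h5
        rw [← sq_abs, ← Real.sq_sqrt (show 0 ≤ c / 4 by positivity)]
        gcongr
      nlinarith [sq_nonneg (2 * K (t + τ) - K t)]
    calc c / 4 = ∫ t in t₀..(t₀ + 1), (K t ^ 2 / 2 - c / 4) := by
          rw [intervalIntegral.integral_sub ((hi _ _).div_const 2) (by simp),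
            intervalIntegral.integral_div, intervalIntegral.integral_const, ← hcdef]
          simp; ring
      _ ≤ ∫ t in t₀..(t₀ + 1), K (t + τ) ^ 2 :=
          intervalIntegral.integral_mono_on (by linarith)
            (((hi _ _).div_const 2).sub (by simp))
            ((hc.comp (continuous_add_const τ)).intervalIntegrable _ _) fun t _ => hle t
      _ = ∫ t in (t₀ + τ)..(t₀ + 1 + τ), K t ^ 2 :=
          intervalIntegral.integral_comp_add_right (fun t => K t ^ 2) τ
      _ ≤ _ := hmono (by linarith) (by linarith) (by linarith)
  have hsum : ∀ n : ℕ, n * (c / 4) ≤ ∫ t in (0 : ℝ)..(n * (L + 1)), K t ^ 2 := by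
    intro n
    induction n with
    | zero => simp
    | succ n ih =>
      have h1 := hblock (n * (L + 1))
      have h2 := intervalIntegral.integral_add_adjacent_intervals (hi 0 (n * (L + 1)))
        (hi (n * (L + 1)) (n * (L + 1) + (L + 1)))
      push_cast
      rw [show ((n : ℝ) + 1) * (L + 1) = n * (L + 1) + (L + 1) by ring, ← h2]
      linarith
  have htop : Tendsto (fun n : ℕ => (n : ℝ) * (L + 1)) atTop atTop :=
    tendsto_natCast_atTop_atTop.atTop_mul_const (by linarith)
  -- The `8` is `4` from the window bound times `2`, as the averaging length is at most `2T` for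
  -- either `J`.
  have hlow : ∀ᶠ n : ℕ in atTop,
      c / (8 * (L + 1)) ≤ intervalMean J (fun t => K t ^ 2) (n * (L + 1)) := by
    filter_upwards [eventually_gt_atTop 0] with n hn
    have hn' : (0 : ℝ) < n := by exact_mod_cast hn
    have hT : 0 < (n : ℝ) * (L + 1) := by positivity
    have h1 := leftFactor_nonneg J
    have h2 := leftFactor_le_one J
    have h3 := (hsum n).trans (hmono (a' := -(leftFactor J * (n * (L + 1))))
      (by have := mul_nonneg h1 hT.le; linarith) hT.le le_rfl)
    calc c / (8 * (L + 1)) = (2 * (n * (L + 1)))⁻¹ * (n * (c / 4)) := by field_simp; norm_num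
      _ ≤ ((1 + leftFactor J) * (n * (L + 1)))⁻¹ * (n * (c / 4)) := by
          gcongr
          linarith
      _ ≤ _ := by
          rw [intervalMean, smul_eq_mul]
          exact mul_le_mul_of_nonneg_left h3 (intervalMean_scale_nonneg hT.le)
  have := ge_of_tendsto (hlim.comp htop) hlow
  have : 0 < c / (8 * (L + 1)) := by positivity
  linarith

variable {X : Type*} [NormedAddCommGroup X]

/-- In a decomposition of a function in `EAP₀` the almost periodic part vanishes. -/
theorem eq_zero_of_EAPZero_eq_add {𝕜 : Type*} [RCLike 𝕜] [NormedSpace 𝕜 X]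
    (hJ : IsHalfLineOrLine J) {f g h : J →ᵇ X} (hf : f ∈ EAPZero 𝕜 J X) (hg : g ∈ AP J X)
    (hh : h ∈ PAPZero J X) (hfgh : f = g + h) : g = 0 := by
  let _ : NormedSpace ℝ X := NormedSpace.restrictScalars ℝ 𝕜 X
  have : IsScalarTower ℝ 𝕜 X := RestrictScalars.isScalarTower ℝ 𝕜 X
  obtain ⟨l, hl, hlim⟩ := exists_filter_of_mem_closure hf.2
  by_contra hne
  obtain ⟨t₀, ht₀⟩ := DFunLike.ne_iff.1 hne
  -- A real functional detecting `g t₀` reduces the question to scalar functions.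
  obtain ⟨φ, hφ⟩ := SeparatingDual.exists_ne_zero (R := ℝ) ht₀
  obtain ⟨G, hG, hGg⟩ := hg
  set k : J →ᵇ ℝ := φ.compLeftContinuousBounded J g with hk
  have hkG : ∀ t : J, k t = φ (G t) := fun t => by rw [← hGg]; rfl
  have hkAP : k ∈ AP J ℝ := ⟨fun t => φ (G t), hG.clm_comp φ, hkG⟩
  set F : J →ᵇ ℝ := φ.compLeftContinuousBounded J f with hF
  have h1 : HasMean (fun t => k t • F t) 0 := hasMean_smul_of_tendsto hJ hkAP fun Φ =>
    hlim (Φ.comp (φ.compLeftContinuousBounded J))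
  have h2 : HasMean (fun t => -(k t * φ (h t))) 0 := by
    refine HasMean.of_norm_le hJ h.continuous.norm hh (C := ‖k‖ * ‖φ‖) fun t => ?_
    rw [norm_neg, norm_mul, mul_assoc]
    exact mul_le_mul (k.norm_coe_le_norm t) (φ.le_opNorm _) (norm_nonneg _) (norm_nonneg _)
  have h3 := h1.add hJ (k.continuous.smul F.continuous)
    (k.continuous.mul (φ.continuous.comp h.continuous)).neg h2
  rw [add_zero, hasMean_iff hJ (U := fun t => φ (G t) ^ 2)] at h3
  · refine (hG.clm_comp φ).not_tendsto_intervalMean_sq (t₀ := t₀) ?_ h3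
    rw [← hGg]; exact hφ
  · intro t
    have : F t = k t + φ (h t) := by
      simp [hF, hk, hfgh]
    change k t • F t + -(k t * φ (h t)) = _
    rw [this, ← hkG, smul_eq_mul]
    ring

section Fourier

/-- The function `t ↦ cos(ωt)` on `J`. -/
noncomputable def cosOn (J : AddSubmonoid ℝ) (ω : ℝ) : J →ᵇ ℝ :=
  BoundedContinuousFunction.ofNormedAddCommGroup (fun t : J => Real.cos (ω * t)) (by fun_prop) 1
    fun _ => Real.abs_cos_le_one _

/-- The function `t ↦ sin(ωt)` on `J`. -/
noncomputable def sinOn (J : AddSubmonoid ℝ) (ω : ℝ) : J →ᵇ ℝ :=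
  BoundedContinuousFunction.ofNormedAddCommGroup (fun t : J => Real.sin (ω * t)) (by fun_prop) 1
    fun _ => Real.abs_sin_le_one _

lemma cosOn_mem_AP (ω : ℝ) : cosOn J ω ∈ AP J ℝ := ⟨_, isBohrAP_cos ω, fun _ => rfl⟩

lemma sinOn_mem_AP (ω : ℝ) : sinOn J ω ∈ AP J ℝ := ⟨_, isBohrAP_sin ω, fun _ => rfl⟩

theorem hasRealFourierCoeff_zero [NormedSpace ℝ X] (hJ : IsHalfLineOrLine J) {f : J →ᵇ X}
    (hf : f ∈ EAPZero ℝ J X ∪ PAPZero J X) (ω : ℝ) : HasRealFourierCoeff f ω 0 0 := by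
  rcases hf with hf | hf
  · obtain ⟨l, hl, hlim⟩ := exists_filter_of_mem_closure hf.2
    exact ⟨hasMean_smul_of_tendsto hJ (cosOn_mem_AP ω) hlim,
      hasMean_smul_of_tendsto hJ (sinOn_mem_AP ω) hlim⟩
  · constructor <;> refine HasMean.of_norm_le hJ f.continuous.norm hf (C := 1) fun t => ?_
    · rw [norm_smul]; gcongr; exact Real.abs_cos_le_one _
    · rw [norm_smul]; gcongr; exact Real.abs_sin_le_one _

theorem hasFourierCoeff_zero [NormedSpace ℂ X] (hJ : IsHalfLineOrLine J) {f : J →ᵇ X}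
    (hf : f ∈ EAPZero ℂ J X ∪ PAPZero J X) (ω : ℝ) : HasFourierCoeff f ω 0 := by
  rcases hf with hf | hf
  · obtain ⟨l, hl, hlim⟩ := exists_filter_of_mem_closure hf.2
    -- The multiplier result has real `k`, so the factor `-i` of the sine is absorbed into the
    -- function.
    set A : X →L[ℝ] X := (-Complex.I) • ContinuousLinearMap.id ℝ X with hA
    set F : J →ᵇ X := A.compLeftContinuousBounded J f with hF
    have h1 : HasMean (fun t => cosOn J ω t • f t) 0 :=
      hasMean_smul_of_tendsto hJ (cosOn_mem_AP ω) hlim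
    have h2 : HasMean (fun t => sinOn J ω t • F t) 0 :=
      hasMean_smul_of_tendsto hJ (sinOn_mem_AP ω) fun Φ =>
        hlim (Φ.comp (A.compLeftContinuousBounded J))
    have h3 := h1.add hJ ((cosOn J ω).continuous.smul f.continuous)
      ((sinOn J ω).continuous.smul F.continuous) h2
    rw [add_zero] at h3
    unfold HasFourierCoeff
    convert h3 using 2 with t
    have h4 : F t = (-Complex.I) • f t := rfl
    have h5 : cosOn J ω t = Real.cos (ω * t) := rfl
    have h6 : sinOn J ω t = Real.sin (ω * t) := rfl
    change _ = cosOn J ω t • f t + sinOn J ω t • F t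
    rw [h4, h5, h6, ← Complex.coe_smul, ← Complex.coe_smul, smul_smul, ← add_smul]
    congr 1
    rw [show -(Complex.I * ((ω * t : ℝ) : ℂ)) = ((-(ω * t) : ℝ) : ℂ) * Complex.I by
      push_cast; ring, Complex.exp_mul_I, ← Complex.ofReal_cos, ← Complex.ofReal_sin,
      Real.cos_neg, Real.sin_neg]
    push_cast
    ring
  · refine HasMean.of_norm_le hJ f.continuous.norm hf (C := 1) fun t => ?_
    rw [norm_smul, show -(Complex.I * ((ω * t : ℝ) : ℂ)) = ((-(ω * t) : ℝ) : ℂ) * Complex.I by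
      push_cast; ring, Complex.norm_exp_ofReal_mul_I]

end Fourier

end AlmostPeriodic

/-! ### Waves with weakly null translates -/

namespace AlmostPeriodic

section Wave

variable (𝕜 : Type*) [RCLike 𝕜] {X : Type*} [NormedAddCommGroup X] [NormedSpace 𝕜 X]

/-- The function which on each interval `[n, n + 1]` is a sine wave in the direction of `v n`, and
which vanishes on the negative half line. -/
noncomputable def wave (v : ℕ → X) (t : ℝ) : X :=
  ((Real.sin (Real.pi * max t 0) : ℝ) : 𝕜) • v ⌊t⌋₊

variable {𝕜} {v : ℕ → X}

lemma norm_wave (v : ℕ → X) (t : ℝ) :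
    ‖wave 𝕜 v t‖ = |Real.sin (Real.pi * max t 0)| * ‖v ⌊t⌋₊‖ := by
  rw [wave, norm_smul, RCLike.norm_ofReal]

lemma wave_of_nonpos (v : ℕ → X) {t : ℝ} (ht : t ≤ 0) : wave 𝕜 v t = 0 := by
  simp [wave, max_eq_right ht]

lemma norm_wave_le (hv : ∀ n, ‖v n‖ ≤ 1) (t : ℝ) : ‖wave 𝕜 v t‖ ≤ 1 := by
  rw [norm_wave]
  exact mul_le_one₀ (Real.abs_sin_le_one _) (norm_nonneg _) (hv _)

lemma abs_sin_pi_mul_le (x : ℝ) (n : ℕ) : |Real.sin (Real.pi * x)| ≤ Real.pi * |x - n| := by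
  have h := Real.abs_sin_sub_sin_le (Real.pi * x) (n * Real.pi)
  rwa [Real.sin_nat_mul_pi, sub_zero, mul_comm (n : ℝ), ← mul_sub, abs_mul,
    abs_of_pos Real.pi_pos] at h

/-- Changes of direction occur only at integers, where the sine vanishes; if one lies between `s`
and `t`, both values are compared with the zero there. -/
lemma norm_wave_sub_le (hv : ∀ n, ‖v n‖ ≤ 1) (s t : ℝ) :
    ‖wave 𝕜 v s - wave 𝕜 v t‖ ≤ Real.pi * |s - t| := by
  wlog hst : s ≤ t generalizing s t
  · rw [norm_sub_rev, abs_sub_comm]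
    exact this t s (le_of_not_ge hst)
  have hpi := Real.pi_pos
  have hmax : |max s 0 - max t 0| ≤ |s - t| := abs_max_sub_max_le_abs s t 0
  rcases (Nat.floor_mono hst).eq_or_lt with h | h
  · rw [wave, wave, h, ← sub_smul, ← RCLike.ofReal_sub, norm_smul, RCLike.norm_ofReal]
    calc _ ≤ |Real.sin (Real.pi * max s 0) - Real.sin (Real.pi * max t 0)| * 1 := by
          gcongr; exact hv _
      _ ≤ |Real.pi * max s 0 - Real.pi * max t 0| := by
          rw [mul_one]; exact Real.abs_sin_sub_sin_le _ _
      _ = Real.pi * |max s 0 - max t 0| := by rw [← mul_sub, abs_mul, abs_of_pos hpi]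
      _ ≤ _ := by gcongr
  · set n := ⌊t⌋₊ with hn
    have hn0 : n ≠ 0 := (Nat.zero_le _).trans_lt h |>.ne'
    have ht0 : 0 ≤ t := by
      by_contra ht0
      exact hn0 (Nat.floor_of_nonpos (not_le.1 ht0).le)
    have ht : (n : ℝ) ≤ t := Nat.floor_le ht0
    have hs : s < n := Nat.lt_of_floor_lt h
    have hmt : max t 0 = t := max_eq_left ht0
    have hms : max s 0 ≤ n := max_le hs.le (Nat.cast_nonneg n)
    calc _ ≤ ‖wave 𝕜 v s‖ + ‖wave 𝕜 v t‖ := norm_sub_le _ _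
      _ ≤ Real.pi * |max s 0 - n| + Real.pi * |max t 0 - n| := by
          rw [norm_wave, norm_wave]
          exact add_le_add
            ((mul_le_of_le_one_right (abs_nonneg _) (hv _)).trans (abs_sin_pi_mul_le _ _))
            ((mul_le_of_le_one_right (abs_nonneg _) (hv _)).trans (abs_sin_pi_mul_le _ _))
      _ ≤ Real.pi * |s - t| := by
          rw [← mul_add]
          gcongr
          rw [hmt, abs_of_nonpos (by linarith : max s 0 - n ≤ 0), abs_of_nonneg (by linarith : 0 ≤ t - n),
            abs_of_nonpos (by linarith : s - t ≤ 0)]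
          linarith [le_max_left s 0]

lemma continuous_wave (hv : ∀ n, ‖v n‖ ≤ 1) : Continuous (wave 𝕜 v) :=
  (LipschitzWith.of_dist_le_mul (K := NNReal.pi) fun s t => by
    rw [dist_eq_norm, Real.dist_eq]; exact norm_wave_sub_le hv s t).continuous

variable (𝕜) in
/-- The restriction to `J` of `wave 𝕜 v`. -/
noncomputable def waveOn (J : AddSubmonoid ℝ) (hv : ∀ n, ‖v n‖ ≤ 1) : J →ᵇ X :=
  BoundedContinuousFunction.ofNormedAddCommGroup (fun t : J => wave 𝕜 v t)
    ((continuous_wave hv).comp continuous_subtype_val) 1 fun _ => norm_wave_le hv _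

variable {J : AddSubmonoid ℝ}

lemma waveOn_apply (hv : ∀ n, ‖v n‖ ≤ 1) (t : J) : waveOn 𝕜 J hv t = wave 𝕜 v t := rfl

lemma continuous_shift_waveOn (hv : ∀ n, ‖v n‖ ≤ 1) : Continuous (shift (waveOn 𝕜 J hv)) := by
  refine (LipschitzWith.of_dist_le_mul (K := NNReal.pi) fun s t => ?_).continuous
  rw [BoundedContinuousFunction.dist_le (by positivity)]
  intro x
  rw [shift_apply, shift_apply, waveOn_apply, waveOn_apply, dist_eq_norm]
  refine (norm_wave_sub_le hv _ _).trans_eq ?_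
  rw [Subtype.dist_eq, Real.dist_eq]
  simp

variable (𝕜) in
/-- The norms of sums of `N` terms of `e` with coefficients of modulus at most `1` are `o(N)`. -/
def SublinearSums (e : ℕ → X) : Prop :=
  ∀ δ : ℝ, 0 < δ → ∃ N : ℕ, 0 < N ∧ ∀ F : Finset ℕ, F.card ≤ N → ∀ a : ℕ → 𝕜, (∀ n, ‖a n‖ ≤ 1) →
    ‖∑ n ∈ F, a n • e n‖ ≤ δ * N

lemma SublinearSums.of_le_rpow {e : ℕ → X} {θ : ℝ} (h0 : 0 ≤ θ) (h1 : θ < 1)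
    (h : ∀ (F : Finset ℕ) (a : ℕ → 𝕜), (∀ n, ‖a n‖ ≤ 1) →
      ‖∑ n ∈ F, a n • e n‖ ≤ (F.card : ℝ) ^ θ) : SublinearSums 𝕜 e := by
  intro δ hδ
  have hlim := (tendsto_rpow_neg_atTop (sub_pos.2 h1)).comp tendsto_natCast_atTop_atTop
  obtain ⟨N, hN, hN0⟩ := ((hlim.eventually (gt_mem_nhds hδ)).and (eventually_gt_atTop 0)).exists
  have hN0' : (0 : ℝ) < N := by exact_mod_cast hN0
  refine ⟨N, hN0, fun F hF a ha => (h F a ha).trans ?_⟩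
  calc (F.card : ℝ) ^ θ ≤ (N : ℝ) ^ θ := by gcongr
    _ = (N : ℝ) ^ (-(1 - θ)) * N := by
        nth_rw 3 [← Real.rpow_one (N : ℝ)]
        rw [← Real.rpow_add hN0']
        congr 1
        ring
    _ ≤ δ * N := by gcongr; exact hN.le

lemma SublinearSums.mul {e : ℕ → X} (he : SublinearSums 𝕜 e) {c : ℕ → 𝕜} (hc : ∀ n, ‖c n‖ ≤ 1) :
    SublinearSums 𝕜 fun n => c n • e n := by
  intro δ hδ
  obtain ⟨N, hN, h⟩ := he δ hδ
  refine ⟨N, hN, fun F hF a ha => ?_⟩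
  simp_rw [smul_smul]
  exact h F hF _ fun n => (norm_mul_le _ _).trans (mul_le_one₀ (ha n) (norm_nonneg _) (hc n))

/-- Combinations of translates of a wave by separated points are controlled by the sums of `v`. -/
lemma norm_sum_smul_wave_le {F : Finset J} (hF : ∀ s ∈ F, ∀ t ∈ F, s ≠ t → 1 ≤ |(s : ℝ) - t|)
    {N : ℕ} (hN : F.card ≤ N) {C : ℝ}
    (hC : ∀ F : Finset ℕ, F.card ≤ N → ∀ a : ℕ → 𝕜, (∀ n, ‖a n‖ ≤ 1) →
      ‖∑ n ∈ F, a n • v n‖ ≤ C) {a : J → 𝕜} (ha : ∀ s, ‖a s‖ ≤ 1) (t : ℝ) :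
    ‖∑ s ∈ F, a s • wave 𝕜 v (s + t)‖ ≤ C := by
  classical
  -- The natural floor sends all negative numbers to `0` and would spoil injectivity; the discarded
  -- terms vanish anyway. On the rest, points at distance at least `1` have distinct floors.
  set F' := F.filter fun s : J => 0 ≤ (s : ℝ) + t with hF'
  set p : J → ℕ := fun s => ⌊(s : ℝ) + t⌋₊ with hp
  have hinj : Set.InjOn p F' := by
    intro s hs s' hs' hss
    obtain ⟨hs, hs0⟩ := Finset.mem_filter.1 (Finset.mem_coe.1 hs)
    obtain ⟨hs', hs0'⟩ := Finset.mem_filter.1 (Finset.mem_coe.1 hs')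
    by_contra hne
    have h1 := hF s hs s' hs' hne
    have h2 := Nat.floor_le hs0
    have h3 := Nat.floor_le hs0'
    have h4 := Nat.lt_floor_add_one ((s : ℝ) + t)
    have h5 := Nat.lt_floor_add_one ((s' : ℝ) + t)
    have h6 : ((⌊(s : ℝ) + t⌋₊ : ℕ) : ℝ) = (⌊(s' : ℝ) + t⌋₊ : ℕ) := by exact_mod_cast hss
    have h7 : |(s : ℝ) - s'| < 1 := by rw [abs_lt]; constructor <;> linarith
    linarith
  have hsum : ∑ s ∈ F, a s • wave 𝕜 v (s + t) = ∑ s ∈ F', a s • wave 𝕜 v (s + t) := by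
    rw [hF', Finset.sum_filter_of_ne]
    intro s _ hs
    by_contra hneg
    exact hs (by rw [wave_of_nonpos v (not_le.1 hneg).le, smul_zero])
  set b : ℕ → 𝕜 := fun n => a (Function.invFunOn p F' n) *
    ((Real.sin (Real.pi * max ((Function.invFunOn p F' n : J) + t) 0) : ℝ) : 𝕜) with hb
  have hsum' : ∑ s ∈ F', a s • wave 𝕜 v (s + t) = ∑ n ∈ F'.image p, b n • v n := by
    rw [Finset.sum_image hinj]
    refine Finset.sum_congr rfl fun s hs => ?_
    have h1 : Function.invFunOn p F' (p s) = s := hinj.leftInvOn_invFunOn hs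
    simp only [hb]
    rw [h1, wave, smul_smul]
  rw [hsum, hsum']
  refine hC _ (Finset.card_image_le.trans ((Finset.card_filter_le _ _).trans hN)) b fun n => ?_
  rw [hb, norm_mul, RCLike.norm_ofReal]
  exact mul_le_one₀ (ha _) (abs_nonneg _) (Real.abs_sin_le_one _)

/-- An unbounded set of reals has arbitrarily large finite separated subsets. -/
lemma exists_separated_finset {A : Set J} (hA : ∀ R : ℝ, ∃ s ∈ A, R < |(s : ℝ)|) (N : ℕ) :
    ∃ F : Finset J, F.card = N ∧ (∀ s ∈ F, s ∈ A) ∧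
      ∀ s ∈ F, ∀ t ∈ F, s ≠ t → 1 ≤ |(s : ℝ) - t| := by
  classical
  induction N with
  | zero => exact ⟨∅, by simp⟩
  | succ N ih =>
    obtain ⟨F, hcard, hFA, hF⟩ := ih
    -- Exceeding this bound puts `s` at distance at least `1` from every earlier point.
    obtain ⟨s, hsA, hs⟩ := hA (∑ t ∈ F, |(t : ℝ)| + 1)
    have hsep : ∀ t ∈ F, 1 ≤ |(s : ℝ) - t| := fun t ht => by
      have h1 : |(t : ℝ)| ≤ ∑ t ∈ F, |(t : ℝ)| :=
        Finset.single_le_sum (f := fun t : J => |(t : ℝ)|) (fun _ _ => abs_nonneg _) ht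
      linarith [abs_sub_abs_le_abs_sub (s : ℝ) t]
    have hsF : s ∉ F := fun h => by
      have := hsep s h
      simp at this
      linarith
    refine ⟨insert s F, by rw [Finset.card_insert_of_notMem hsF, hcard], ?_, ?_⟩
    · intro t ht
      rcases Finset.mem_insert.1 ht with rfl | ht
      exacts [hsA, hFA t ht]
    · intro t ht t' ht' hne
      rcases Finset.mem_insert.1 ht with h | h <;> rcases Finset.mem_insert.1 ht' with h' | h'
      · exact absurd (h.trans h'.symm) hne
      · rw [h]; exact hsep t' h'
      · rw [h', abs_sub_comm]; exact hsep t h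
      · exact hF t h t' h' hne

/-- If `Φ` were at least `ε` in modulus on an unbounded set of translates, `N` separated ones with
unimodular coefficients aligning the values would give `N ε ≤ ‖Φ‖ · o(N)`. -/
lemma tendsto_apply_shift_waveOn (hJ : IsHalfLineOrLine J) (hv : ∀ n, ‖v n‖ ≤ 1)
    (hs : SublinearSums 𝕜 v) (Φ : StrongDual 𝕜 (J →ᵇ X)) :
    Tendsto (fun s => Φ (shift (waveOn 𝕜 J hv) s)) (cocompact J) (𝓝 0) := by
  rw [Metric.tendsto_nhds]
  intro ε hε
  set A : Set J := {s | ε ≤ ‖Φ (shift (waveOn 𝕜 J hv) s)‖} with hA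
  by_cases hbd : ∃ R : ℝ, ∀ s ∈ A, |(s : ℝ)| ≤ R
  · obtain ⟨R, hR⟩ := hbd
    have hcomp : IsCompact ((Subtype.val : J → ℝ) ⁻¹' Metric.closedBall 0 R) :=
      hJ.isClosed.isClosedEmbedding_subtypeVal.isCompact_preimage (isCompact_closedBall 0 R)
    filter_upwards [hcomp.compl_mem_cocompact] with s hs
    rw [dist_zero_right]
    by_contra hle
    exact hs (by simpa using hR s (not_lt.1 hle))
  · push Not at hbd
    exfalso
    obtain ⟨N, hN, hsN⟩ := hs (ε / (‖Φ‖ + 1)) (by positivity)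
    obtain ⟨F, hcard, hFA, hF⟩ := exists_separated_finset hbd N
    choose a ha1 ha2 using fun s : J =>
      RCLike.exists_norm_eq_mul_self (Φ (shift (waveOn 𝕜 J hv) s))
    have hN' : (0 : ℝ) < N := by exact_mod_cast hN
    have h1 : ‖∑ s ∈ F, a s • shift (waveOn 𝕜 J hv) s‖ ≤ ε / (‖Φ‖ + 1) * N := by
      refine (BoundedContinuousFunction.norm_le (by positivity)).2 fun t => ?_
      have := norm_sum_smul_wave_le hF hcard.le hsN (fun s => (ha1 s).le) (t : ℝ)
      simpa [BoundedContinuousFunction.sum_apply, waveOn_apply] using this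
    have h2 : Φ (∑ s ∈ F, a s • shift (waveOn 𝕜 J hv) s)
        = ((∑ s ∈ F, ‖Φ (shift (waveOn 𝕜 J hv) s)‖ : ℝ) : 𝕜) := by
      simp [map_sum, ha2]
    have h3 : N * ε ≤ ∑ s ∈ F, ‖Φ (shift (waveOn 𝕜 J hv) s)‖ := by
      rw [← hcard, ← nsmul_eq_mul]
      exact Finset.card_nsmul_le_sum _ _ _ fun s hs => hFA s hs
    have h4 := Φ.le_opNorm (∑ s ∈ F, a s • shift (waveOn 𝕜 J hv) s)
    rw [h2, RCLike.norm_ofReal, abs_of_nonneg (Finset.sum_nonneg fun _ _ => norm_nonneg _)] at h4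
    have h5 : N * ε ≤ ‖Φ‖ * (ε / (‖Φ‖ + 1) * N) := h3.trans (h4.trans (by gcongr))
    have h6 : ‖Φ‖ * (ε / (‖Φ‖ + 1) * N) = N * ε * (‖Φ‖ / (‖Φ‖ + 1)) := by ring
    have h7 : ‖Φ‖ / (‖Φ‖ + 1) < 1 := (div_lt_one (by positivity)).2 (by linarith)
    have h8 : 0 < N * ε := by positivity
    rw [h6] at h5
    nlinarith

lemma IsHalfLineOrLine.noncompactSpace (hJ : IsHalfLineOrLine J) : NoncompactSpace J := by
  refine ⟨fun h => ?_⟩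
  obtain ⟨M, hM⟩ := (h.image continuous_subtype_val).bddAbove
  have := hM ⟨⟨|M| + 1, hJ.mem_of_nonneg (by positivity)⟩, Set.mem_univ _, rfl⟩
  linarith [le_abs_self M]

/-- The orbit map is weakly continuous with limit `0` at infinity, so the orbit together with `0` is
weakly compact. -/
lemma waveOn_mem_EAPZero (hJ : IsHalfLineOrLine J) (hv : ∀ n, ‖v n‖ ≤ 1)
    (hs : SublinearSums 𝕜 v) : waveOn 𝕜 J hv ∈ EAPZero 𝕜 J X := by
  set γ : J → WeakSpace 𝕜 (J →ᵇ X) :=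
    fun s => toWeakSpace 𝕜 (J →ᵇ X) (shift (waveOn 𝕜 J hv) s) with hγ
  have hcont : Continuous γ :=
    (toWeakSpaceCLM 𝕜 (J →ᵇ X)).continuous.comp (continuous_shift_waveOn hv)
  have hlim : Tendsto γ (cocompact J) (𝓝 (toWeakSpace 𝕜 (J →ᵇ X) 0)) := by
    refine (WeakBilin.tendsto_iff_forall_eval_tendsto (topDualPairing 𝕜 (J →ᵇ X)).flip ?_).2
      fun Φ => ?_
    · intro x y h
      by_contra hne
      obtain ⟨Φ, hΦ⟩ := SeparatingDual.exists_separating_of_ne (R := 𝕜) hne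
      exact hΦ (DFunLike.congr_fun h Φ)
    · change Tendsto (fun s => Φ (shift (waveOn 𝕜 J hv) s)) _ (𝓝 (Φ 0))
      rw [map_zero]
      exact tendsto_apply_shift_waveOn hJ hv hs Φ
  have := hJ.noncompactSpace
  exact ⟨(hlim.isCompact_insert_range_of_cocompact hcont).closure_of_subset
      (Set.subset_insert _ _),
    mem_closure_of_tendsto hlim (Eventually.of_forall fun s => ⟨s, rfl⟩)⟩

end Wave

end AlmostPeriodic

/-! ### Means destroyed by gaps -/

namespace AlmostPeriodic

variable {J : AddSubmonoid ℝ}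

/-- Periodic pulses on the intervals `[4^k, 2 * 4^k]`, separated by the gaps `[2 * 4^k, 4^(k+1)]`,
do not have a mean. -/
lemma not_tendsto_intervalMean_of_gaps {U w : ℝ → ℝ} (hU : Continuous U) (hw : Continuous w)
    (hper : Function.Periodic w 1) (hw0 : 0 < ∫ t in (0 : ℝ)..1, w t) (hU0 : ∀ t ≤ 0, U t = 0)
    (hpulse : ∀ k : ℕ, ∀ t ∈ Set.Icc ((4 : ℝ) ^ k) (2 * 4 ^ k), U t = w t)
    (hgap : ∀ k : ℕ, ∀ t ∈ Set.Icc ((2 : ℝ) * 4 ^ k) (4 * 4 ^ k), U t = 0) (m : ℝ) :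
    ¬ Tendsto (intervalMean J U) atTop (𝓝 m) := by
  intro hlim
  set c := ∫ t in (0 : ℝ)..1, w t with hc
  have hi : ∀ a b, IntervalIntegrable U volume a b := fun a b => hU.intervalIntegrable a b
  set I : ℝ → ℝ := fun T => ∫ t in (0 : ℝ)..T, U t with hI
  have hmean : ∀ T : ℝ, 0 ≤ T → intervalMean J U T = ((1 + leftFactor J) * T)⁻¹ * I T := by
    intro T hT
    have h0 : ∫ t in (-(leftFactor J * T))..0, U t = 0 := by
      rw [intervalIntegral.integral_congr (g := fun _ => (0 : ℝ))]
      · simp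
      · intro t ht
        rw [Set.uIcc_of_le (by simpa using mul_nonneg (leftFactor_nonneg J) hT)] at ht
        exact hU0 t ht.2
    rw [intervalMean, ← intervalIntegral.integral_add_adjacent_intervals (hi _ 0) (hi 0 T), h0,
      zero_add, smul_eq_mul]
  have hI2 : ∀ k : ℕ, I (2 * 4 ^ k) = I (4 ^ k) + 4 ^ k * c := by
    intro k
    have h4 : (0 : ℝ) < 4 ^ k := by positivity
    have h1 : ∫ t in ((4 : ℝ) ^ k)..(2 * 4 ^ k), U t = ∫ t in ((4 : ℝ) ^ k)..(2 * 4 ^ k), w t := by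
      refine intervalIntegral.integral_congr fun t ht => hpulse k t ?_
      rwa [Set.uIcc_of_le (by linarith)] at ht
    -- A pulse block comprises exactly `4 ^ k` periods of `w`.
    have h2 := hper.intervalIntegral_add_zsmul_eq (4 ^ k) ((4 : ℝ) ^ k)
      (fun a b => hw.intervalIntegrable a b)
    have h3 : ∫ t in ((4 : ℝ) ^ k)..(4 ^ k + 1), w t = c := by
      rw [hper.intervalIntegral_add_eq _ 0, zero_add]
    rw [h3] at h2
    simp only [zsmul_eq_mul, mul_one] at h2
    push_cast at h2
    rw [← two_mul] at h2
    simp only [hI]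
    rw [← intervalIntegral.integral_add_adjacent_intervals (hi 0 (4 ^ k)) (hi _ _), h1, h2]
  have hI4 : ∀ k : ℕ, I (4 * 4 ^ k) = I (2 * 4 ^ k) := by
    intro k
    have h4 : (0 : ℝ) < 4 ^ k := by positivity
    have h1 : ∫ t in ((2 : ℝ) * 4 ^ k)..(4 * 4 ^ k), U t = 0 := by
      rw [intervalIntegral.integral_congr (g := fun _ => (0 : ℝ))]
      · simp
      · intro t ht
        rw [Set.uIcc_of_le (by linarith)] at ht
        exact hgap k t ht
    simp only [hI]
    rw [← intervalIntegral.integral_add_adjacent_intervals (hi 0 (2 * 4 ^ k)) (hi _ _), h1,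
      add_zero]
  have hpow : Tendsto (fun k : ℕ => (4 : ℝ) ^ k) atTop atTop :=
    tendsto_pow_atTop_atTop_of_one_lt (by norm_num)
  have hl : 0 < 1 + leftFactor J := by linarith [leftFactor_nonneg J]
  have t1 := hlim.comp hpow
  have t2 := hlim.comp (hpow.const_mul_atTop (show (0 : ℝ) < 2 by norm_num))
  have t4 := hlim.comp (hpow.const_mul_atTop (show (0 : ℝ) < 4 by norm_num))
  -- Passing from `4^k` to `2 * 4^k` adds a full pulse block, which forces `m = (1 + leftFactor J)⁻¹
  -- * c > 0`; passing on to `4 * 4^k` adds nothing, which forces `m = 0`.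
  have e2 : m = 2⁻¹ * (m + (1 + leftFactor J)⁻¹ * c) := by
    refine tendsto_nhds_unique t2 (((t1.add_const _).const_mul (2⁻¹ : ℝ)).congr fun k => ?_)
    have h4 : (0 : ℝ) < 4 ^ k := by positivity
    simp only [Function.comp_apply]
    rw [hmean _ h4.le, hmean _ (by positivity), hI2]
    field_simp
  have e4 : m = 2⁻¹ * m := by
    refine tendsto_nhds_unique t4 ((t2.const_mul (2⁻¹ : ℝ)).congr fun k => ?_)
    have h4 : (0 : ℝ) < 4 ^ k := by positivity
    simp only [Function.comp_apply]
    rw [hmean _ (by positivity), hmean _ (by positivity), hI4]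
    field_simp
    ring
  have hcpos : 0 < (1 + leftFactor J)⁻¹ * c := by positivity
  linarith

section

variable {𝕜 : Type*} [RCLike 𝕜] {X : Type*} [NormedAddCommGroup X] [NormedSpace 𝕜 X]

variable (𝕜) in
/-- The indicator function of the integers in the blocks `[4^k, 2 * 4^k)`. -/
noncomputable def blockIndicator (n : ℕ) : 𝕜 := if Even (Nat.log 2 n) then 1 else 0

lemma norm_blockIndicator_le (n : ℕ) : ‖blockIndicator 𝕜 n‖ ≤ 1 := by
  unfold blockIndicator; split_ifs <;> simp

lemma log_two_floor {k : ℕ} {t : ℝ} (h1 : (2 : ℝ) ^ k ≤ t) (h2 : t < 2 ^ (k + 1)) :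
    Nat.log 2 ⌊t⌋₊ = k := by
  have h0 : 0 ≤ t := le_trans (by positivity) h1
  have h3 : 2 ^ k ≤ ⌊t⌋₊ := Nat.le_floor (by exact_mod_cast h1)
  exact Nat.log_eq_of_pow_le_of_lt_pow h3 ((Nat.floor_lt h0).2 (by exact_mod_cast h2))

lemma two_pow_two_mul (k : ℕ) : (2 : ℝ) ^ (2 * k) = 4 ^ k := by rw [pow_mul]; norm_num

variable {e : ℕ → X}

lemma norm_blockIndicator_smul_le (he : ∀ n, ‖e n‖ = 1) (n : ℕ) :
    ‖blockIndicator 𝕜 n • e n‖ ≤ 1 := by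
  rw [norm_smul, he, mul_one]
  exact norm_blockIndicator_le n

lemma norm_wave_pulse (he : ∀ n, ‖e n‖ = 1) (k : ℕ) {t : ℝ}
    (ht : t ∈ Set.Icc ((4 : ℝ) ^ k) (2 * 4 ^ k)) :
    ‖wave 𝕜 (fun n => blockIndicator 𝕜 n • e n) t‖ = |Real.sin (Real.pi * t)| := by
  have h0 : 0 ≤ t := le_trans (by positivity) ht.1
  rw [norm_wave, max_eq_left h0]
  -- The right endpoint already belongs to the next dyadic block, but the sine vanishes there.
  rcases ht.2.eq_or_lt with h | h
  · have : Real.sin (Real.pi * t) = 0 := by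
      rw [h, mul_comm]
      exact_mod_cast Real.sin_nat_mul_pi (2 * 4 ^ k)
    simp [this]
  · have := log_two_floor (k := 2 * k) (t := t) (by rw [two_pow_two_mul]; exact ht.1)
      (by rw [pow_succ, two_pow_two_mul, mul_comm]; exact h)
    rw [blockIndicator, this, if_pos (even_two_mul k), one_smul, he, mul_one]

lemma norm_wave_gap (k : ℕ) {t : ℝ} (ht : t ∈ Set.Icc ((2 : ℝ) * 4 ^ k) (4 * 4 ^ k)) :
    ‖wave 𝕜 (fun n => blockIndicator 𝕜 n • e n) t‖ = 0 := by
  have h0 : 0 ≤ t := le_trans (by positivity) ht.1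
  rw [norm_wave, max_eq_left h0]
  rcases ht.2.eq_or_lt with h | h
  · have : Real.sin (Real.pi * t) = 0 := by
      rw [h, mul_comm]
      exact_mod_cast Real.sin_nat_mul_pi (4 * 4 ^ k)
    simp [this]
  · have := log_two_floor (k := 2 * k + 1) (t := t)
      (by rw [pow_succ, two_pow_two_mul, mul_comm]; exact ht.1)
      (by rw [pow_succ, pow_succ, two_pow_two_mul]; linarith)
    rw [blockIndicator, this, if_neg (by simp), zero_smul, norm_zero, mul_zero]

lemma not_hasMean_norm_waveOn_pow (hJ : IsHalfLineOrLine J) (he : ∀ n, ‖e n‖ = 1) {q : ℕ}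
    (hq : q ≠ 0) :
    ¬ ∃ m : ℝ, HasMean
      (fun t => ‖waveOn 𝕜 J (norm_blockIndicator_smul_le (𝕜 := 𝕜) he) t‖ ^ q) m := by
  rintro ⟨m, hm⟩
  replace hm := (hasMean_iff hJ
    (U := fun t => ‖wave 𝕜 (fun n => blockIndicator 𝕜 n • e n) t‖ ^ q) (fun t => rfl) m).1 hm
  have hw : Continuous fun t : ℝ => |Real.sin (Real.pi * t)| ^ q := by fun_prop
  refine not_tendsto_intervalMean_of_gaps
    ((continuous_wave (norm_blockIndicator_smul_le he)).norm.pow q) hw ?_ ?_ ?_ ?_ ?_ m hm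
  · intro t
    simp only
    rw [mul_add, mul_one, Real.sin_add_pi, abs_neg]
  · exact intervalIntegral.integral_pos one_pos hw.continuousOn (fun _ _ => by positivity)
      ⟨1 / 2, by norm_num, by rw [mul_one_div, Real.sin_pi_div_two]; simp⟩
  · intro t ht
    simp [wave_of_nonpos _ ht, hq]
  · intro k t ht
    exact congrArg (· ^ q) (norm_wave_pulse he k ht)
  · intro k t ht
    exact (congrArg (· ^ q) (norm_wave_gap k ht)).trans (zero_pow hq)

/-- A normalized sequence with sublinear sums yields a function in `EAP₀` that is not pseudo almost
periodic. -/
theorem InclusionFails.of_sublinearSums (hJ : IsHalfLineOrLine J) (he : ∀ n, ‖e n‖ = 1)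
    (hs : SublinearSums 𝕜 e) : InclusionFails 𝕜 J X := by
  set f := waveOn 𝕜 J (norm_blockIndicator_smul_le (𝕜 := 𝕜) he) with hf
  have hf0 : f ∈ EAPZero 𝕜 J X :=
    waveOn_mem_EAPZero hJ _ (hs.mul norm_blockIndicator_le)
  have h1 : ¬ ∃ m : ℝ, HasMean (fun t => ‖f t‖) m := by
    simpa using not_hasMean_norm_waveOn_pow (𝕜 := 𝕜) hJ he one_ne_zero
  have h2 : f ∉ PAP J X := by
    rintro ⟨g, hg, h, hh, hfgh⟩
    have := eq_zero_of_EAPZero_eq_add hJ hf0 hg hh hfgh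
    rw [this, zero_add] at hfgh
    exact h1 ⟨0, hfgh ▸ hh⟩
  exact ⟨fun h => h2 (h hf0.1), f, hf0, h1, not_hasMean_norm_waveOn_pow hJ he two_ne_zero, h2⟩

end

/-! ### Hilbert spaces, `ℓ^p` and `c₀` -/

section Spaces

variable {𝕜 : Type*} [RCLike 𝕜]

theorem InclusionFails.hilbert (hJ : IsHalfLineOrLine J) {H : Type*} [NormedAddCommGroup H]
    [InnerProductSpace 𝕜 H] [CompleteSpace H] (hH : ¬ FiniteDimensional 𝕜 H) :
    InclusionFails 𝕜 J H := by
  obtain ⟨w, b, -⟩ := exists_hilbertBasis 𝕜 H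
  have hw : Infinite w := by
    by_contra hfin
    rw [not_infinite_iff_finite] at hfin
    have := Fintype.ofFinite w
    exact hH b.toOrthonormalBasis.toBasis.finiteDimensional_of_finite
  have ho : Orthonormal 𝕜 fun n => b (Infinite.natEmbedding w n) :=
    b.orthonormal.comp _ (Infinite.natEmbedding w).injective
  -- By Pythagoras, `N` orthonormal terms with coefficients of modulus at most `1` have a sum of
  -- norm at most `√N`.
  refine .of_sublinearSums hJ ho.1 (.of_le_rpow (θ := 1 / 2) (by norm_num) (by norm_num) ?_)
  intro F a ha
  rw [← Real.sqrt_eq_rpow]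
  refine Real.le_sqrt_of_sq_le ?_
  rw [← RCLike.ofReal_le_ofReal (K := 𝕜), RCLike.ofReal_pow, ← inner_self_eq_norm_sq_to_K,
    ho.inner_sum]
  simp_rw [RCLike.conj_mul]
  norm_cast
  calc ∑ n ∈ F, ‖a n‖ ^ 2 ≤ ∑ n ∈ F, (1 : ℝ) :=
        Finset.sum_le_sum fun n _ => pow_le_one₀ (norm_nonneg _) (ha n)
    _ = F.card := by simp

/-- Sums of `N` unit vectors grow like `N ^ (1 / p)`, which is sublinear precisely because `p > 1`;
for `p = ∞` they stay bounded. -/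
theorem InclusionFails.lp (hJ : IsHalfLineOrLine J) (p : ℝ≥0∞) [Fact (1 ≤ p)] (hp : 1 < p) :
    InclusionFails 𝕜 J (lp (fun _ : ℕ => 𝕜) p) := by
  refine .of_sublinearSums (e := fun n => lp.single p n (1 : 𝕜)) hJ
    (fun n => by rw [lp.norm_single (zero_lt_one.trans hp), norm_one]) ?_
  have hsmul : ∀ (a : ℕ → 𝕜) (n : ℕ),
      a n • lp.single (E := fun _ : ℕ => 𝕜) p n (1 : 𝕜) = lp.single p n (a n) := fun a n => by
    rw [← lp.single_smul, smul_eq_mul, mul_one]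
  rcases eq_or_ne p ⊤ with rfl | hp'
  · refine .of_le_rpow (θ := 0) le_rfl one_pos fun F a ha => ?_
    rw [Real.rpow_zero]
    refine lp.norm_le_of_forall_le zero_le_one fun i => ?_
    simp only [hsmul]
    rw [lp.coeFn_sum, Finset.sum_apply]
    simp only [lp.coeFn_single]
    by_cases hi : i ∈ F
    · rw [Finset.sum_eq_single i (fun j _ hj => by simp [hj.symm]) (fun h => absurd hi h)]
      simpa using ha i
    · rw [Finset.sum_eq_zero fun j hj => by simp [show i ≠ j by rintro rfl; exact hi hj]]
      simp
  · have hp1 : 1 < p.toReal := by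
      rw [← ENNReal.toReal_one]
      exact (ENNReal.toReal_lt_toReal ENNReal.one_ne_top hp').2 hp
    refine .of_le_rpow (θ := p.toReal⁻¹) (by positivity) (inv_lt_one_of_one_lt₀ hp1)
      fun F a ha => ?_
    simp only [hsmul]
    rw [Real.le_rpow_inv_iff_of_pos (norm_nonneg _) (by positivity) (by positivity),
      lp.norm_sum_single (by positivity)]
    calc ∑ n ∈ F, ‖a n‖ ^ p.toReal ≤ ∑ n ∈ F, (1 : ℝ) :=
          Finset.sum_le_sum fun n _ => Real.rpow_le_one (norm_nonneg _) (ha n) (by positivity)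
      _ = F.card := by simp

variable (𝕜) in
/-- The unit vectors of `c₀`. -/
noncomputable def zeroAtInftySingle (n : ℕ) : C₀(ℕ, 𝕜) where
  toFun := Pi.single n 1
  continuous_toFun := continuous_of_discreteTopology
  zero_at_infty' := by
    rw [cocompact_eq_cofinite]
    refine tendsto_const_nhds.congr' ?_
    filter_upwards [(Set.finite_singleton n).compl_mem_cofinite] with m hm
    simp [Pi.single_eq_of_ne (show m ≠ n from hm)]

lemma zeroAtInfty_norm_le {f : C₀(ℕ, 𝕜)} {C : ℝ} (hC : 0 ≤ C) (h : ∀ n, ‖f n‖ ≤ C) : ‖f‖ ≤ C := by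
  rw [← ZeroAtInftyContinuousMap.norm_toBCF_eq_norm]
  exact (BoundedContinuousFunction.norm_le hC).2 h

lemma zeroAtInftySingle_apply (n m : ℕ) :
    zeroAtInftySingle 𝕜 n m = if m = n then 1 else 0 := Pi.single_apply n 1 m

lemma norm_zeroAtInftySingle (n : ℕ) : ‖zeroAtInftySingle 𝕜 n‖ = 1 := by
  refine le_antisymm (zeroAtInfty_norm_le zero_le_one fun m => ?_) ?_
  · rw [zeroAtInftySingle_apply]; split_ifs <;> simp
  · have := (zeroAtInftySingle 𝕜 n).toBCF.norm_coe_le_norm n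
    rw [ZeroAtInftyContinuousMap.norm_toBCF_eq_norm] at this
    refine le_trans (le_of_eq ?_) this
    change 1 = ‖zeroAtInftySingle 𝕜 n n‖
    simp [zeroAtInftySingle_apply]

theorem InclusionFails.zeroAtInfty (hJ : IsHalfLineOrLine J) : InclusionFails 𝕜 J C₀(ℕ, 𝕜) := by
  refine .of_sublinearSums hJ norm_zeroAtInftySingle
    (.of_le_rpow (θ := 0) le_rfl one_pos fun F a ha => ?_)
  rw [Real.rpow_zero]
  refine zeroAtInfty_norm_le zero_le_one fun i => ?_
  have hsum : (∑ n ∈ F, a n • zeroAtInftySingle 𝕜 n) i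
      = ∑ n ∈ F, (a n • zeroAtInftySingle 𝕜 n) i :=
    map_sum ({ toFun := fun f => f i, map_zero' := rfl, map_add' := fun _ _ => rfl } :
      C₀(ℕ, 𝕜) →+ 𝕜) _ F
  rw [hsum]
  simp only [ZeroAtInftyContinuousMap.smul_apply, zeroAtInftySingle_apply, smul_eq_mul, mul_ite,
    mul_one, mul_zero, Finset.sum_ite_eq]
  split_ifs
  · exact ha i
  · simp

end Spaces

end AlmostPeriodic

theorem mainTheorem2 (𝕜 : Type v) [RCLike 𝕜] (J : AddSubmonoid ℝ)
    (hJ : AlmostPeriodic.IsHalfLineOrLine J) :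
    -- failure of the inclusion for infinite-dimensional Hilbert spaces, `ℓ^p` and `c₀`
    (∀ (H : Type u) [NormedAddCommGroup H] [InnerProductSpace 𝕜 H] [CompleteSpace H],
      ¬ FiniteDimensional 𝕜 H → AlmostPeriodic.InclusionFails 𝕜 J H) ∧
    (∀ (p : ℝ≥0∞) [Fact (1 ≤ p)], 1 < p →
      AlmostPeriodic.InclusionFails 𝕜 J (lp (fun _ : ℕ => 𝕜) p)) ∧
    AlmostPeriodic.InclusionFails 𝕜 J C₀(ℕ, 𝕜) ∧
    -- in a splitting of a function in `EAP₀` the almost periodic part vanishes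
    (∀ (X : Type u) [NormedAddCommGroup X] [NormedSpace 𝕜 X] [CompleteSpace X],
      ∀ f ∈ AlmostPeriodic.EAPZero 𝕜 J X,
      ∀ g ∈ AlmostPeriodic.AP J X, ∀ h ∈ AlmostPeriodic.PAPZero J X,
        f = g + h → g = 0 ∧ f ∈ AlmostPeriodic.PAPZero J X) ∧
    -- the Fourier coefficients of functions in `EAP₀` and in `PAP₀` vanish
    (∀ (X : Type u) [NormedAddCommGroup X] [NormedSpace ℂ X] [CompleteSpace X],
      ∀ f ∈ AlmostPeriodic.EAPZero ℂ J X ∪ AlmostPeriodic.PAPZero J X,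
        ∀ ω : ℝ, AlmostPeriodic.HasFourierCoeff f ω 0) ∧
    (∀ (X : Type u) [NormedAddCommGroup X] [NormedSpace ℝ X] [CompleteSpace X],
      ∀ f ∈ AlmostPeriodic.EAPZero ℝ J X ∪ AlmostPeriodic.PAPZero J X,
        ∀ ω : ℝ, AlmostPeriodic.HasRealFourierCoeff f ω 0 0) :=
  ⟨fun _ _ _ _ hH => .hilbert hJ hH, fun p _ hp => .lp hJ p hp, .zeroAtInfty hJ,
    fun X _ _ _ f hf g hg h hh hfgh => by
      have h0 := AlmostPeriodic.eq_zero_of_EAPZero_eq_add hJ hf hg hh hfgh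
      rw [h0, zero_add] at hfgh
      exact ⟨h0, hfgh ▸ hh⟩,
    fun X _ _ _ f hf ω => AlmostPeriodic.hasFourierCoeff_zero hJ hf ω,
    fun X _ _ _ f hf ω => AlmostPeriodic.hasRealFourierCoeff_zero hJ hf ω⟩
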